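/- Let $\Gamma$ be a weighted digraph without loops on $n$ vertices, with strictly positive arc weights; let $w_{ij}$ be the weight of the arc $(i,j)$, and $w_{ij}=0$ if there is no such arc. Let $L=(\ell_{ij})$ be its Laplacian matrix: $\ell_{ij}=-w_{ij}$ for $j\neq i$ and $\ell_{ii}=\sum_{k\neq i}w_{ik}$. An in-forest of $\Gamma$ is a spanning subgraph each of whose weak components is a converging tree, i.e. has one vertex (the root) of outdegree $0$ while all its other vertices have outdegree $1$. The weight of an in-forest is the product of the weights of its arcs (equal to $1$ if there are none). Let $d$ be the minimum number of trees in an in-forest of $\Gamma$ (the in-forest dimension); the in-forests with the maximum number of arcs have $n-d$ arcs. Let $\tilde J=(\tilde J_{ij})$ be the normalized matrix of maximum in-forests: $\tilde J_{ij}$ is the total weight of the in-forests with $n-d$ arcs in which $i$ belongs to a tree with root $j$, divided by the total weight of all in-forests with $n-d$ arcs. (i) For every $\alpha\in\mathbb{C}$, the multiset of the eigenvalues of $L+\alpha\tilde J$, counted with algebraic multiplicity, consists of all nonzero eigenvalues of $L$ with their multiplicities, together with $d$ further copies of $\alpha$. In particular, if $\alpha$ is not a nonzero eigenvalue of $L$,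 then the multiplicity of $\alpha$ as an eigenvalue of $L+\alpha\tilde J$ is exactly $d$. (ii) $L+\alpha\tilde J$ is nonsingular for every $\alpha\in\mathbb{C}$ with $\alpha\neq0$. -/

import Mathlib

/-- A weighted digraph without loops on the vertex set `V`, given by its matrix of arc weights.
There is an arc from `i` to `j` iff the weight of `(i, j)` is nonzero, and arc weights are
strictly positive. -/
structure WeightedDigraph (V : Type*) where
  /-- The matrix of arc weights. -/
  weight : V → V → ℝ
  weight_nonneg : ∀ i j, 0 ≤ weight i j
  weight_self : ∀ i, weight i i = 0

/-- The undirected graph underlying the digraph on `V` with arc set `A`. -/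
def underlyingGraph {V : Type*} (A : Finset (V × V)) : SimpleGraph V :=
  SimpleGraph.fromRel fun i j => (i, j) ∈ A

/-- The outdegree of `v` in the digraph on `V` with arc set `A`. -/
def outdegree {V : Type*} [DecidableEq V] (A : Finset (V × V)) (v : V) : ℕ :=
  (A.filter fun e => e.1 = v).card

/-- The weak component `c` of the digraph on `V` with arc set `A` is a converging tree with root
`r`: the vertex `r` of `c` has outdegree zero, and the remaining vertices of `c` have outdegree
one. (All arcs starting in `c` stay in `c`, so outdegrees in `c` and in the digraph agree.) -/
def IsConvergingTree {V : Type*} [DecidableEq V] (A : Finset (V × V))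
    (c : (underlyingGraph A).ConnectedComponent) (r : V) : Prop :=
  r ∈ c.supp ∧ outdegree A r = 0 ∧ ∀ v ∈ c.supp, v ≠ r → outdegree A v = 1

/-- The digraph on `V` with arc set `A` is a converging forest: all its weak components are
converging trees. -/
def IsConvergingForest {V : Type*} [DecidableEq V] (A : Finset (V × V)) : Prop :=
  ∀ c : (underlyingGraph A).ConnectedComponent, ∃ r, IsConvergingTree A c r

/-- The number of trees (weak components) of the forest on `V` with arc set `A`. -/
noncomputable def numTrees {V : Type*} (A : Finset (V × V)) : ℕ :=
  Nat.card (underlyingGraph A).ConnectedComponent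

namespace WeightedDigraph

open Classical in
/-- The arc set of a weighted digraph. -/
noncomputable def arcs {V : Type*} [Fintype V] (Γ : WeightedDigraph V) : Finset (V × V) :=
  Finset.univ.filter fun e => Γ.weight e.1 e.2 ≠ 0

/-- The weight of the subgraph with arc set `A`: the product of the weights of its arcs. -/
noncomputable def subgraphWeight {V : Type*} (Γ : WeightedDigraph V) (A : Finset (V × V)) : ℝ :=
  ∏ e ∈ A, Γ.weight e.1 e.2

open Classical in
/-- The in-forests of `Γ`, i.e. its spanning converging forests. A spanning subgraph is given by
its arc set. -/
noncomputable def inForests {V : Type*} [Fintype V] [DecidableEq V] (Γ : WeightedDigraph V) :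
    Finset (Finset (V × V)) :=
  Γ.arcs.powerset.filter IsConvergingForest

/-- The in-forests of `Γ` with `k` arcs. -/
noncomputable def inForestsWith {V : Type*} [Fintype V] [DecidableEq V] (Γ : WeightedDigraph V)
    (k : ℕ) : Finset (Finset (V × V)) :=
  Γ.inForests.filter fun F => F.card = k

open Classical in
/-- The in-forests of `Γ` with `k` arcs in which `i` belongs to a tree converging to `j`. -/
noncomputable def inForestsFromTo {V : Type*} [Fintype V] [DecidableEq V] (Γ : WeightedDigraph V)
    (k : ℕ) (i j : V) : Finset (Finset (V × V)) :=
  (Γ.inForestsWith k).filter fun F =>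
    IsConvergingTree F ((underlyingGraph F).connectedComponentMk i) j

/-- The in-forest dimension of `Γ`: the minimum number of trees in an in-forest of `Γ`. -/
noncomputable def inForestDim {V : Type*} [Fintype V] [DecidableEq V] (Γ : WeightedDigraph V) :
    ℕ :=
  sInf {t | ∃ F ∈ Γ.inForests, numTrees F = t}

/-- The total weight `σ_k` of the in-forests of `Γ` with `k` arcs. -/
noncomputable def sigma {V : Type*} [Fintype V] [DecidableEq V] (Γ : WeightedDigraph V) (k : ℕ) :
    ℝ :=
  ∑ F ∈ Γ.inForestsWith k, Γ.subgraphWeight F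

/-- The matrix `Q_k` of in-forests of `Γ` with `k` arcs. -/
noncomputable def forestMatrix {V : Type*} [Fintype V] [DecidableEq V] (Γ : WeightedDigraph V)
    (k : ℕ) : Matrix V V ℝ :=
  Matrix.of fun i j => ∑ F ∈ Γ.inForestsFromTo k i j, Γ.subgraphWeight F

/-- The normalized matrix `J_k = σ_k⁻¹ Q_k` of in-forests of `Γ` with `k` arcs. -/
noncomputable def normalizedForestMatrix {V : Type*} [Fintype V] [DecidableEq V]
    (Γ : WeightedDigraph V) (k : ℕ) : Matrix V V ℝ :=
  (Γ.sigma k)⁻¹ • Γ.forestMatrix k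

/-- The normalized matrix of maximum in-forests: `J_{n-d}`, where `n` is the number of vertices
and `d` is the in-forest dimension. -/
noncomputable def maxForestMatrix {V : Type*} [Fintype V] [DecidableEq V]
    (Γ : WeightedDigraph V) : Matrix V V ℝ :=
  Γ.normalizedForestMatrix (Fintype.card V - Γ.inForestDim)

/-- The (row) Laplacian matrix: the `(i, j)` entry is `-w_ij` for `j ≠ i`, and all row sums are
zero. -/
noncomputable def laplacian {V : Type*} [Fintype V] [DecidableEq V] (Γ : WeightedDigraph V) :
    Matrix V V ℝ :=
  Matrix.of fun i j =>
    if j = i then ∑ k ∈ Finset.univ.filter (fun k => k ≠ i), Γ.weight i k else -Γ.weight i j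

/-- The Laplacian matrix as a complex matrix. -/
noncomputable def laplacianC {V : Type*} [Fintype V] [DecidableEq V] (Γ : WeightedDigraph V) :
    Matrix V V ℂ :=
  Γ.laplacian.map Complex.ofReal

/-- The normalized matrix of maximum in-forests as a complex matrix. -/
noncomputable def maxForestMatrixC {V : Type*} [Fintype V] [DecidableEq V]
    (Γ : WeightedDigraph V) : Matrix V V ℂ :=
  Γ.maxForestMatrix.map Complex.ofReal

end WeightedDigraph

/-! Give each arc `(u, v)` the weight `X * w u v`. Sorting forests by the out-arc of one vertex
yields the matrix forest identity `(1 + X L) Q(X) = σ(X)` (`sum_isInForest_rootOf`). Its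
coefficients form the recurrence `Q_{k+1} + L Q_k = σ_{k+1}`, `Q_0 = σ_0`
(`forestMatrix_succ_and_zero`), so every `Q_k` is a polynomial in `L`. No forest has more than `n -
d` arcs, hence `L J = 0` and `J = 1 - L M` with `M` commuting with `L`. Thus `J` is idempotent, and
counting roots of maximum forests shows that its trace is `d`.

The rest is linear algebra. From `L J = 0`, `(X - L)(X - α J) = X (X - L - α J)`; the spectrum of `α
J` is known from idempotence and trace, and invertibility of `L + J` shows that 0 has multiplicity
`d` in `L` (`roots_charpoly_add_smul`). -/

open Relation

/-- In the digraph with arc set `A`, the vertex `j` has no outgoing arc. -/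
def IsTerminal {V : Type*} (A : Finset (V × V)) (j : V) : Prop := ∀ v, (j, v) ∉ A

/-- There is a directed path from `i` to the terminal vertex `j`. -/
def RootOf {V : Type*} (A : Finset (V × V)) (i j : V) : Prop :=
  ReflTransGen (fun u v => (u, v) ∈ A) i j ∧ IsTerminal A j

/-- Every vertex has at most one outgoing arc. -/
def IsFunctionalArcs {V : Type*} (A : Finset (V × V)) : Prop :=
  ∀ u v v', (u, v) ∈ A → (u, v') ∈ A → v = v'

/-- Every vertex has at most one outgoing arc and a directed path to a terminal vertex. -/
def IsInForest {V : Type*} (A : Finset (V × V)) : Prop :=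
  IsFunctionalArcs A ∧ ∀ i, ∃ j, RootOf A i j

/-! ### Forests described by directed paths to roots -/

section Forest

variable {V : Type*} {A : Finset (V × V)}

theorem IsTerminal.eq_of_reflTransGen {i j : V} (hi : IsTerminal A i)
    (h : ReflTransGen (fun u v => (u, v) ∈ A) i j) : i = j := by
  rcases h.cases_head with h | ⟨c, hc, -⟩
  · exact h
  · exact absurd hc (hi c)

theorem IsTerminal.rootOf_iff {i j : V} (hi : IsTerminal A i) : RootOf A i j ↔ i = j := by
  constructor
  · exact fun h => hi.eq_of_reflTransGen h.1
  · rintro rfl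
    exact ⟨.refl, hi⟩

theorem IsFunctionalArcs.reflTransGen_of_arc (hA : IsFunctionalArcs A) {u v r : V}
    (huv : (u, v) ∈ A) (hur : u ≠ r) (h : ReflTransGen (fun u v => (u, v) ∈ A) u r) :
    ReflTransGen (fun u v => (u, v) ∈ A) v r := by
  rcases h.cases_head with h | ⟨c, hc, hcr⟩
  · exact absurd h hur
  · rwa [hA u v c huv hc]

theorem RootOf.of_arc (hA : IsFunctionalArcs A) {u v r : V} (huv : (u, v) ∈ A)
    (h : RootOf A u r) : RootOf A v r := by
  refine ⟨hA.reflTransGen_of_arc huv ?_ h.1, h.2⟩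
  rintro rfl
  exact h.2 v huv

theorem RootOf.of_reflTransGen (hA : IsFunctionalArcs A) {u v r : V}
    (huv : ReflTransGen (fun u v => (u, v) ∈ A) u v) (h : RootOf A u r) : RootOf A v r := by
  induction huv with
  | refl => exact h
  | tail _ h2 ih => exact ih.of_arc hA h2

theorem RootOf.unique (hA : IsFunctionalArcs A) {i r s : V} (hr : RootOf A i r)
    (hs : RootOf A i s) : r = s :=
  (hr.2.rootOf_iff).1 (hs.of_reflTransGen hA hr.1)

theorem RootOf.eq_iff (hA : IsFunctionalArcs A) {i r s : V} (hr : RootOf A i r) :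
    RootOf A i s ↔ r = s :=
  ⟨hr.unique hA, fun h => h ▸ hr⟩

theorem reflTransGen_mono_arcs {B : Finset (V × V)} (hAB : A ⊆ B) {u v : V}
    (h : ReflTransGen (fun u v => (u, v) ∈ A) u v) :
    ReflTransGen (fun u v => (u, v) ∈ B) u v :=
  ReflTransGen.mono (fun _ _ h => hAB h) _ _ h

theorem connectedComponentMk_eq_of_arc {u v : V} (h : (u, v) ∈ A) :
    (underlyingGraph A).connectedComponentMk u = (underlyingGraph A).connectedComponentMk v := by
  by_cases huv : u = v
  · rw [huv]
  · exact SimpleGraph.ConnectedComponent.sound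
      (SimpleGraph.Adj.reachable ⟨huv, Or.inl h⟩)

theorem connectedComponentMk_eq_of_reflTransGen {u v : V}
    (h : ReflTransGen (fun u v => (u, v) ∈ A) u v) :
    (underlyingGraph A).connectedComponentMk u = (underlyingGraph A).connectedComponentMk v := by
  induction h with
  | refl => rfl
  | tail _ h2 ih => exact ih.trans (connectedComponentMk_eq_of_arc h2)

theorem of_underlyingGraph_reachable {p : V → Prop}
    (hp : ∀ u v, (u, v) ∈ A → (p u ↔ p v)) {u v : V}
    (h : (underlyingGraph A).Reachable u v) (hu : p u) : p v := by
  rw [SimpleGraph.reachable_iff_reflTransGen] at h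
  induction h with
  | refl => exact hu
  | tail _ h2 ih =>
    rcases h2.2 with h2 | h2
    · exact (hp _ _ h2).1 ih
    · exact (hp _ _ h2).2 ih

theorem IsFunctionalArcs.rootOf_iff_of_arc (hA : IsFunctionalArcs A) {r u v : V}
    (h : (u, v) ∈ A) : RootOf A u r ↔ RootOf A v r :=
  ⟨fun hu => hu.of_arc hA h, fun hv => ⟨.head h hv.1, hv.2⟩⟩

theorem IsFunctionalArcs.rootOf_of_component_eq (hA : IsFunctionalArcs A) {r u v : V}
    (h : (underlyingGraph A).connectedComponentMk u = (underlyingGraph A).connectedComponentMk v)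
    (hu : RootOf A u r) : RootOf A v r :=
  of_underlyingGraph_reachable (p := fun x => RootOf A x r)
    (fun _ _ h => hA.rootOf_iff_of_arc h) (SimpleGraph.ConnectedComponent.exact h) hu

-- Having root `r` is invariant along arcs, hence constant on weak components, so each component
-- contains exactly one terminal vertex.
open Classical in
theorem IsInForest.numTrees_eq [Fintype V] (hA : IsInForest A) :
    numTrees A = (Finset.univ.filter (IsTerminal A)).card := by
  rw [numTrees, ← Fintype.card_subtype, ← Nat.card_eq_fintype_card]
  symm
  refine Nat.card_eq_of_bijective
    (fun r : {r // IsTerminal A r} => (underlyingGraph A).connectedComponentMk r.1) ⟨?_, ?_⟩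
  · rintro ⟨r, hr⟩ ⟨s, hs⟩ h
    have := hA.1.rootOf_of_component_eq h (hr.rootOf_iff.2 rfl)
    exact Subtype.ext (hs.rootOf_iff.1 this).symm
  · intro c
    induction c using SimpleGraph.ConnectedComponent.ind with | _ v
    obtain ⟨r, hr⟩ := hA.2 v
    exact ⟨⟨r, hr.2⟩, (connectedComponentMk_eq_of_reflTransGen hr.1).symm⟩

variable [DecidableEq V]

theorem outdegree_eq_zero_iff {v : V} : outdegree A v = 0 ↔ IsTerminal A v := by
  simp only [outdegree, Finset.card_eq_zero, Finset.filter_eq_empty_iff, IsTerminal, Prod.forall]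
  grind

theorem outdegree_le_one_iff : (∀ v, outdegree A v ≤ 1) ↔ IsFunctionalArcs A := by
  simp only [outdegree, Finset.card_le_one, Finset.mem_filter, IsFunctionalArcs]
  constructor
  · intro h u v v' hv hv'
    exact congrArg Prod.snd (h u (u, v) ⟨hv, rfl⟩ (u, v') ⟨hv', rfl⟩)
  · rintro h u ⟨a, b⟩ ⟨hab, rfl⟩ ⟨c, d⟩ ⟨hcd, rfl⟩
    rw [h _ _ _ hab hcd]

theorem IsConvergingTree.rootOf (hA : IsFunctionalArcs A)
    {c : (underlyingGraph A).ConnectedComponent} {r v : V}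
    (h : IsConvergingTree A c r) (hv : v ∈ c.supp) : RootOf A v r := by
  refine hA.rootOf_of_component_eq (h.1.trans hv.symm) ?_
  exact ⟨.refl, outdegree_eq_zero_iff.1 h.2.1⟩

/-- This trades weak components for directed reachability. With at most one out-arc per vertex, the
vertices leading to a given root are closed under arcs in both directions, so they fill its whole
component. -/
theorem isConvergingForest_iff : IsConvergingForest A ↔ IsInForest A := by
  constructor
  · intro h
    have hA : IsFunctionalArcs A := by
      rw [← outdegree_le_one_iff]
      intro v
      obtain ⟨r, hr, h0, h1⟩ := h ((underlyingGraph A).connectedComponentMk v)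
      by_cases hvr : v = r
      · rw [hvr, h0]; exact zero_le_one
      · exact (h1 v rfl hvr).le
    refine ⟨hA, fun i => ?_⟩
    obtain ⟨r, hr⟩ := h ((underlyingGraph A).connectedComponentMk i)
    exact ⟨r, hr.rootOf hA rfl⟩
  · rintro ⟨hA, h⟩ c
    induction c using SimpleGraph.ConnectedComponent.ind with | _ v
    obtain ⟨r, hr⟩ := h v
    refine ⟨r, (connectedComponentMk_eq_of_reflTransGen hr.1).symm,
      outdegree_eq_zero_iff.2 hr.2, fun u hu hur => ?_⟩
    have h1 := outdegree_le_one_iff.2 hA u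
    have h2 : outdegree A u ≠ 0 := by
      rw [Ne, outdegree_eq_zero_iff]
      intro h0
      exact hur (h0.rootOf_iff.1 (hA.rootOf_of_component_eq hu.symm hr))
    omega

theorem IsInForest.isConvergingTree_iff (hA : IsInForest A) {i j : V} :
    IsConvergingTree A ((underlyingGraph A).connectedComponentMk i) j ↔ RootOf A i j := by
  constructor
  · exact fun h => h.rootOf hA.1 rfl
  · intro h
    obtain ⟨r, hr⟩ := isConvergingForest_iff.2 hA ((underlyingGraph A).connectedComponentMk i)
    rwa [h.unique hA.1 (hr.rootOf hA.1 rfl)]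

theorem IsInForest.numTrees_add_card [Fintype V] (hA : IsInForest A) :
    numTrees A + A.card = Fintype.card V := by
  classical
  have h1 : A.card = ∑ v, outdegree A v :=
    Finset.card_eq_sum_card_fiberwise (fun _ _ => Finset.mem_coe.2 (Finset.mem_univ _))
  rw [hA.numTrees_eq, h1, Finset.card_filter, ← Finset.sum_add_distrib, ← Finset.card_univ,
    Finset.card_eq_sum_ones]
  refine Finset.sum_congr rfl fun v _ => ?_
  have h2 := outdegree_le_one_iff.2 hA.1 v
  have h3 := outdegree_eq_zero_iff (A := A) (v := v)
  split_ifs with h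
  · rw [h3.2 h]
  · have := mt h3.1 h
    omega

-- The tree rooted at `i` is hung onto the tree containing `m`. No cycle arises because `m` lies
-- outside the tree of `i`, and only vertices formerly rooted at `i` change root.
open Classical in
theorem IsInForest.insert_arc {i m : V} (hA : IsInForest A) (hi : IsTerminal A i)
    (hm : ¬ RootOf A m i) : IsInForest (insert (i, m) A) ∧
      ∀ v j, RootOf (insert (i, m) A) v j ↔
        if RootOf A v i then RootOf A m j else RootOf A v j := by
  have hfun : IsFunctionalArcs (insert (i, m) A) := by
    intro u v v' hv hv'
    have := hA.1 u v v'
    have h1 := hi v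
    have h2 := hi v'
    grind
  have hter : ∀ {v j}, RootOf A v j → j ≠ i → RootOf (insert (i, m) A) v j := by
    intro v j h hj
    refine ⟨reflTransGen_mono_arcs (Finset.subset_insert _ _) h.1, fun u hu => ?_⟩
    have := h.2 u
    grind
  obtain ⟨r, hr⟩ := hA.2 m
  have hri : r ≠ i := by
    rintro rfl
    exact hm hr
  have hvi : ∀ {v}, RootOf A v i → RootOf (insert (i, m) A) v r := by
    intro v h
    refine ⟨.trans (reflTransGen_mono_arcs (Finset.subset_insert _ _) h.1)
      (.head (Finset.mem_insert_self _ _) (hter hr hri).1), (hter hr hri).2⟩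
  refine ⟨⟨hfun, fun v => ?_⟩, fun v j => ?_⟩
  · obtain ⟨s, hs⟩ := hA.2 v
    by_cases hsi : s = i
    · exact ⟨r, hvi (hsi ▸ hs)⟩
    · exact ⟨s, hter hs hsi⟩
  · split_ifs with h
    · rw [(hvi h).eq_iff hfun, hr.eq_iff hA.1]
    · obtain ⟨s, hs⟩ := hA.2 v
      have hsi : s ≠ i := by
        rintro rfl
        exact h hs
      rw [(hter hs hsi).eq_iff hfun, hs.eq_iff hA.1]

theorem IsInForest.erase_arc {i m : V} (hA : IsInForest A) (him : (i, m) ∈ A) :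
    IsInForest (A.erase (i, m)) ∧ IsTerminal (A.erase (i, m)) i ∧
      ¬ RootOf (A.erase (i, m)) m i := by
  have hsub : A.erase (i, m) ⊆ A := Finset.erase_subset _ _
  have hfun : IsFunctionalArcs (A.erase (i, m)) :=
    fun u v v' h h' => hA.1 u v v' (hsub h) (hsub h')
  have hter : IsTerminal (A.erase (i, m)) i := by
    intro v hv
    have := hA.1 i m v him (hsub hv)
    grind
  refine ⟨⟨hfun, fun v => ?_⟩, hter, fun hm => ?_⟩
  · obtain ⟨r, hr⟩ := hA.2 v
    have hrt : IsTerminal (A.erase (i, m)) r := fun u hu => hr.2 u (hsub hu)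
    obtain ⟨h1, -⟩ := hr
    induction h1 using ReflTransGen.head_induction_on with
    | refl => exact ⟨r, .refl, hrt⟩
    | head huv _ ih =>
      rename_i u v _
      by_cases hui : u = i
      · subst hui
        exact ⟨_, .refl, hter⟩
      · obtain ⟨s, hs⟩ := ih
        refine ⟨s, .head ?_ hs.1, hs.2⟩
        simp [huv, hui]
  -- If `m` still led to `i`, the erased arc would close a cycle, and everything reachable from `i`
  -- would lead back to `i`, even its root in `A`.
  · have key : ∀ v, ReflTransGen (fun u v => (u, v) ∈ A) i v →
        ReflTransGen (fun u v => (u, v) ∈ A.erase (i, m)) v i := by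
      intro v hv
      induction hv with
      | refl => exact .refl
      | tail _ h2 ih =>
        rename_i u v _
        by_cases hui : u = i
        · subst hui
          rw [hA.1 _ _ _ h2 him]
          exact hm.1
        · refine hfun.reflTransGen_of_arc ?_ hui ih
          simp [h2, hui]
    obtain ⟨r, hr⟩ := hA.2 i
    have := hr.2.eq_of_reflTransGen (reflTransGen_mono_arcs hsub (key r hr.1))
    subst this
    exact hr.2 m him

end Forest

/-! ### The matrix forest identity over a commutative ring -/

section ForestSums

open Classical Finset Polynomial

variable {V R : Type*} [Fintype V] [DecidableEq V] [CommRing R]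

/-- A sum over forests, organized by the out-arc (if any) of the vertex `i`. -/
theorem sum_isInForest {M : Type*} [AddCommMonoid M] (i : V) (g : Finset (V × V) → M) :
    ∑ F with IsInForest F, g F =
      ∑ f with IsInForest f ∧ IsTerminal f i,
        (g f + ∑ m with ¬ RootOf f m i, g (insert (i, m) f)) := by
  rw [sum_add_distrib, ← sum_filter_add_sum_filter_not (univ.filter IsInForest)
    (fun F => IsTerminal F i), filter_filter, filter_filter]
  congr 1
  rw [sum_sigma']
  symm
  refine sum_bij (fun p _ => insert (i, p.2) p.1) ?_ ?_ ?_ ?_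
  · rintro ⟨f, m⟩ hp
    simp only [mem_sigma, mem_filter, mem_univ, true_and] at hp ⊢
    exact ⟨(hp.1.1.insert_arc hp.1.2 hp.2).1, fun h => h m (mem_insert_self _ _)⟩
  · rintro ⟨f, m⟩ hp ⟨f', m'⟩ hp' h
    simp only [mem_sigma, mem_filter, mem_univ, true_and] at hp hp' h
    have hm : m = m' := by
      have h1 := mem_insert_self (i, m) f
      rw [h, mem_insert] at h1
      rcases h1 with h1 | h1
      · exact congrArg Prod.snd h1
      · exact absurd h1 (hp'.1.2 m)
    subst hm
    have h2 : f = f' := by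
      rw [← erase_insert (hp.1.2 m), h, erase_insert (hp'.1.2 m)]
    rw [h2]
  · intro F hF
    simp only [mem_filter, mem_univ, true_and, IsTerminal, not_forall, not_not] at hF
    obtain ⟨hF, m, hm⟩ := hF
    have h := hF.erase_arc hm
    exact ⟨⟨F.erase (i, m), m⟩, by simpa using ⟨⟨h.1, h.2.1⟩, h.2.2⟩, insert_erase hm⟩
  · intros
    rfl

/-- The matrix forest identity: `(1 + L) Q = σ` for the total weights of all forests. -/
theorem sum_isInForest_rootOf (w : V → V → R) (i j : V) :
    (1 + ∑ m, w i m) *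
        ∑ F with IsInForest F, (if RootOf F i j then ∏ e ∈ F, w e.1 e.2 else 0) =
      ∑ m, w i m *
        ∑ F with IsInForest F, (if RootOf F m j then ∏ e ∈ F, w e.1 e.2 else 0) +
      if i = j then ∑ F with IsInForest F, ∏ e ∈ F, w e.1 e.2 else 0 := by
  -- The identity already holds for each block made of a forest `f` with `i` terminal and its
  -- extensions by an arc out of `i`. Within a block, split the heads `m` by whether they are rooted
  -- at `i` in `f`.
  have key : ∀ f ∈ univ.filter (fun f : Finset (V × V) => IsInForest f ∧ IsTerminal f i),
      (1 + ∑ m, w i m) * ((if RootOf f i j then ∏ e ∈ f, w e.1 e.2 else 0) +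
        ∑ m' with ¬ RootOf f m' i, (if RootOf (insert (i, m') f) i j then
          ∏ e ∈ insert (i, m') f, w e.1 e.2 else 0)) =
      ∑ m, w i m * ((if RootOf f m j then ∏ e ∈ f, w e.1 e.2 else 0) +
        ∑ m' with ¬ RootOf f m' i, (if RootOf (insert (i, m') f) m j then
          ∏ e ∈ insert (i, m') f, w e.1 e.2 else 0)) +
      if i = j then (∏ e ∈ f, w e.1 e.2 +
        ∑ m' with ¬ RootOf f m' i, ∏ e ∈ insert (i, m') f, w e.1 e.2) else 0 := by
    intro f hf
    obtain ⟨hf, hi⟩ := (mem_filter.1 hf).2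
    have hprod : ∀ m, ∏ e ∈ insert (i, m) f, w e.1 e.2 = w i m * ∏ e ∈ f, w e.1 e.2 :=
      fun m => prod_insert (hi m)
    set P := ∏ e ∈ f, w e.1 e.2
    have hins : ∀ v, ∑ m' with ¬ RootOf f m' i, (if RootOf (insert (i, m') f) v j then
          ∏ e ∈ insert (i, m') f, w e.1 e.2 else 0) =
        ∑ m' with ¬ RootOf f m' i, (if (if RootOf f v i then RootOf f m' j else RootOf f v j)
          then w i m' * P else 0) := by
      intro v
      refine sum_congr rfl fun m' hm' => ?_
      simp only [(hf.insert_arc hi (mem_filter.1 hm').2).2 v j, hprod]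
    simp only [hins]
    simp only [hprod, hi.rootOf_iff, if_true]
    rw [← sum_filter_add_sum_filter_not univ (fun m => RootOf f m i)
      (fun m => w i m * (_ + _)), ← sum_filter_add_sum_filter_not univ (fun m => RootOf f m i)
      (fun m => w i m), ← sum_mul]
    have h1 : ∑ m with RootOf f m i, w i m * ((if RootOf f m j then P else 0) +
        ∑ m' with ¬ RootOf f m' i, (if (if RootOf f m i then RootOf f m' j else RootOf f m j)
          then w i m' * P else 0)) =
        (∑ m with RootOf f m i, w i m) * ((if i = j then P else 0) +
        ∑ m' with ¬ RootOf f m' i, (if RootOf f m' j then w i m' * P else 0)) := by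
      rw [sum_mul]
      refine sum_congr rfl fun m hm => ?_
      have hm' := (mem_filter.1 hm).2
      simp only [hm'.eq_iff hf.1, if_true]
    have h2 : ∑ m with ¬ RootOf f m i, w i m * ((if RootOf f m j then P else 0) +
        ∑ m' with ¬ RootOf f m' i, (if (if RootOf f m i then RootOf f m' j else RootOf f m j)
          then w i m' * P else 0)) =
        (∑ m with ¬ RootOf f m i, (if RootOf f m j then w i m * P else 0)) *
        (1 + ∑ m with ¬ RootOf f m i, w i m) := by
      rw [sum_mul]
      refine sum_congr rfl fun m hm => ?_
      have hm' := (mem_filter.1 hm).2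
      simp only [hm', if_false]
      split_ifs
      · rw [← sum_mul]; ring
      · simp
    rw [h1, h2]
    split_ifs with hij
    · subst hij
      have h3 : ∑ m with ¬ RootOf f m i, (if RootOf f m i then w i m * P else 0) = 0 :=
        sum_eq_zero fun m hm => if_neg (mem_filter.1 hm).2
      rw [h3]
      ring
    · ring
  simp only [sum_isInForest i]
  rw [mul_sum, sum_congr rfl key, sum_add_distrib, sum_comm]
  simp only [mul_sum]
  congr 1
  split_ifs
  · rfl
  · simp

omit [DecidableEq V] in
/-- The total weight of the forests with `k` arcs satisfying `p`. -/
theorem coeff_sum_isInForest (w : V → V → R) (p : Finset (V × V) → Prop) (k : ℕ) :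
    (∑ F with IsInForest F, (if p F then ∏ e ∈ F, (X * C (w e.1 e.2) : R[X]) else 0)).coeff k =
      ∑ F with IsInForest F, (if p F ∧ F.card = k then ∏ e ∈ F, w e.1 e.2 else 0) := by
  rw [finsetSum_coeff]
  refine sum_congr rfl fun F _ => ?_
  rw [prod_mul_distrib, prod_const, ← map_prod]
  by_cases hp : p F
  · simp only [hp, if_true, true_and, coeff_X_pow_mul', coeff_C]
    grind
  · simp [hp]

end ForestSums

/-! ### The recurrence for the forest matrices -/

namespace WeightedDigraph

open Finset Polynomial

variable {V : Type*} [Fintype V] [DecidableEq V] (Γ : WeightedDigraph V)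

open Classical in
theorem mem_inForests {F : Finset (V × V)} : F ∈ Γ.inForests ↔ F ⊆ Γ.arcs ∧ IsInForest F := by
  rw [inForests, mem_filter, mem_powerset, isConvergingForest_iff]

theorem mem_inForestsWith {k : ℕ} {F : Finset (V × V)} :
    F ∈ Γ.inForestsWith k ↔ (F ⊆ Γ.arcs ∧ IsInForest F) ∧ F.card = k := by
  rw [inForestsWith, mem_filter, mem_inForests]

open Classical in
theorem mem_inForestsFromTo {k : ℕ} {i j : V} {F : Finset (V × V)} :
    F ∈ Γ.inForestsFromTo k i j ↔ F ∈ Γ.inForestsWith k ∧ RootOf F i j := by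
  rw [inForestsFromTo, mem_filter, and_congr_right_iff]
  intro h
  rw [((Γ.mem_inForestsWith).1 h).1.2.isConvergingTree_iff]

omit [DecidableEq V] in
theorem subgraphWeight_eq_zero {F : Finset (V × V)} (h : ¬ F ⊆ Γ.arcs) :
    Γ.subgraphWeight F = 0 := by
  rw [not_subset] at h
  obtain ⟨e, he, h⟩ := h
  refine prod_eq_zero he ?_
  simpa [arcs] using h

-- Forests using a non-arc have weight zero, so the sum may range over all forests on `V`, as the
-- forest identity requires.
open Classical in
theorem sigma_eq (k : ℕ) :
    Γ.sigma k = ∑ F with IsInForest F, if F.card = k then Γ.subgraphWeight F else 0 := by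
  rw [sigma, ← sum_filter, filter_filter]
  refine sum_subset (fun F hF => ?_) fun F hF h => Γ.subgraphWeight_eq_zero fun h' => h ?_
  · rw [mem_inForestsWith] at hF
    simp [hF]
  · rw [mem_inForestsWith]
    simpa [h'] using hF

open Classical in
theorem forestMatrix_apply (k : ℕ) (i j : V) :
    Γ.forestMatrix k i j =
      ∑ F with IsInForest F, if RootOf F i j ∧ F.card = k then Γ.subgraphWeight F else 0 := by
  rw [forestMatrix, Matrix.of_apply, ← sum_filter, filter_filter]
  refine sum_subset (fun F hF => ?_) fun F hF h => Γ.subgraphWeight_eq_zero fun h' => h ?_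
  · rw [mem_inForestsFromTo, mem_inForestsWith] at hF
    simp [hF]
  · rw [mem_inForestsFromTo, mem_inForestsWith]
    have := (mem_filter.1 hF).2
    tauto

theorem laplacian_mul_apply (Q : Matrix V V ℝ) (i j : V) :
    (Γ.laplacian * Q) i j = ∑ m, Γ.weight i m * Q i j - ∑ m, Γ.weight i m * Q m j := by
  rw [Matrix.mul_apply, ← sum_sub_distrib]
  have h : ∑ k with k ≠ i, Γ.weight i k = ∑ k, Γ.weight i k := by
    rw [sum_filter]
    refine sum_congr rfl fun k _ => ?_
    split_ifs with hk
    · rfl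
    · rw [not_not.1 hk, Γ.weight_self]
  have h2 : ∀ m, Γ.laplacian i m * Q m j =
      (if m = i then (∑ k, Γ.weight i k) * Q i j else 0) - Γ.weight i m * Q m j := by
    intro m
    rw [laplacian, Matrix.of_apply, h]
    split_ifs with hm
    · rw [hm, Γ.weight_self]; ring
    · ring
  simp only [h2, sum_sub_distrib, sum_ite_eq', mem_univ, if_true, sum_mul]

theorem forestMatrix_succ_and_zero :
    (∀ k, Γ.forestMatrix (k + 1) + Γ.laplacian * Γ.forestMatrix k =
      Γ.sigma (k + 1) • (1 : Matrix V V ℝ)) ∧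
    Γ.forestMatrix 0 = Γ.sigma 0 • (1 : Matrix V V ℝ) := by
  classical
  have hQ : ∀ k i j, (∑ F with IsInForest F, (if RootOf F i j then
      ∏ e ∈ F, (X * C (Γ.weight e.1 e.2) : ℝ[X]) else 0)).coeff k = Γ.forestMatrix k i j := by
    intro k i j
    rw [coeff_sum_isInForest Γ.weight (fun F => RootOf F i j), forestMatrix_apply]
    rfl
  have hS : ∀ k, (∑ F with IsInForest F,
      ∏ e ∈ F, (X * C (Γ.weight e.1 e.2) : ℝ[X])).coeff k = Γ.sigma k := by
    intro k
    have := coeff_sum_isInForest Γ.weight (fun _ => True) k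
    simp only [if_true, true_and] at this
    rw [this, sigma_eq]
    rfl
  have hsum : ∀ (f : V → ℝ[X]) k, (∑ m, f m).coeff k = ∑ m, (f m).coeff k :=
    fun f k => finsetSum_coeff univ f k
  -- The variable `X` counts arcs, so the coefficient of degree `k` isolates the forests with `k`
  -- arcs.
  have key := fun i j => sum_isInForest_rootOf (fun u v => (X * C (Γ.weight u v) : ℝ[X])) i j
  constructor
  · intro k
    ext i j
    have h := congrArg (fun p => p.coeff (k + 1)) (key i j)
    simp only [add_mul, one_mul, sum_mul, mul_assoc, coeff_add, hsum,
      apply_ite (fun p : ℝ[X] => p.coeff (k + 1)),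
      coeff_X_mul, coeff_C_mul, hQ, hS, coeff_zero] at h
    rw [Matrix.add_apply, laplacian_mul_apply, Matrix.smul_apply, Matrix.one_apply]
    simp only [smul_eq_mul, mul_ite, mul_one, mul_zero]
    linear_combination h
  · ext i j
    have h := congrArg (fun p => p.coeff 0) (key i j)
    simp only [add_mul, one_mul, sum_mul, mul_assoc, coeff_add, hsum,
      apply_ite (fun p : ℝ[X] => p.coeff 0),
      mul_coeff_zero, coeff_X_zero, zero_mul, sum_const_zero, hQ, hS, coeff_zero] at h
    rw [Matrix.smul_apply, Matrix.one_apply]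
    simp only [smul_eq_mul, mul_ite, mul_one, mul_zero]
    linear_combination h

end WeightedDigraph

/-! ### Spectrum of a matrix perturbed by its projection at 0 -/

section SpectralProjection

open Polynomial

variable {V K : Type*} [Fintype V] [DecidableEq V] [Field K] {A J M : Matrix V V K}

namespace Matrix

/-- Idempotence gives `(μ - α J)(μ - α (1 - J)) = μ (μ - α)`; take determinants. -/
theorem mem_roots_charpoly_smul_of_isIdempotentElem (hJ : IsIdempotentElem J) {α μ : K}
    (hμ : μ ∈ (α • J).charpoly.roots) : μ = 0 ∨ μ = α := by
  have h1 : (scalar V μ - α • J).det = 0 := by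
    rw [← eval_charpoly]
    exact isRoot_of_mem_roots hμ
  have h2 : (scalar V μ - α • J) * (scalar V μ - α • (1 - J)) = (μ * (μ - α)) • 1 := by
    have hJ' : J * J = J := hJ
    simp only [scalar_apply, ← smul_one_eq_diagonal, sub_mul, mul_sub, smul_mul_assoc,
      mul_smul_comm, one_mul, mul_one, smul_sub, smul_smul, hJ']
    module
  have h3 := congrArg det h2
  rw [det_mul, h1, zero_mul, det_smul, det_one, mul_one] at h3
  rcases mul_eq_zero.1 (pow_eq_zero_iff'.1 h3.symm).1 with h | h
  · exact Or.inl h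
  · exact Or.inr (sub_eq_zero.1 h)

/-- Only 0 and `α` can be roots, and the trace `d α` fixes the multiplicity of `α`, by
characteristic zero and `α ≠ 0`. -/
theorem roots_charpoly_smul_of_isIdempotentElem [IsAlgClosed K] [CharZero K]
    (hJ : IsIdempotentElem J) {d : ℕ} (htr : J.trace = d) {α : K} (hα : α ≠ 0) :
    (α • J).charpoly.roots =
      Multiset.replicate (Fintype.card V - d) 0 + Multiset.replicate d α ∧
    d ≤ Fintype.card V := by
  have hmem := fun μ => mem_roots_charpoly_smul_of_isIdempotentElem hJ (α := α) (μ := μ)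
  have hcard : (α • J).charpoly.roots.card = Fintype.card V := by
    rw [splits_iff_card_roots.1 (IsAlgClosed.splits _), charpoly_natDegree_eq_dim]
  have hsum : (α • J).charpoly.roots.sum = d * α := by
    rw [← trace_eq_sum_roots_charpoly, trace_smul, htr, smul_eq_mul, mul_comm]
  generalize (α • J).charpoly.roots = s at hmem hcard hsum
  classical
  have hs : s = Multiset.replicate (s.count 0) 0 + Multiset.replicate (s.count α) α := by
    ext μ
    rw [Multiset.count_add, Multiset.count_replicate, Multiset.count_replicate]
    by_cases h0 : μ = 0
    · subst h0
      simp [hα]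
    · by_cases h1 : μ = α
      · subst h1
        simp [hα.symm]
      · rw [if_neg (Ne.symm h0), if_neg (Ne.symm h1), Multiset.count_eq_zero]
        exact fun h => (hmem μ h).elim h0 h1
  rw [hs] at hsum
  simp only [Multiset.sum_add, Multiset.sum_replicate, smul_zero, zero_add, nsmul_eq_mul] at hsum
  have hd : s.count α = d := by exact_mod_cast mul_right_cancel₀ hα hsum
  have hc := hcard
  rw [hs, Multiset.card_add, Multiset.card_replicate, Multiset.card_replicate, hd] at hc
  refine ⟨?_, by omega⟩
  rw [hs, hd]
  congr 2
  omega

/-- If `J = 1 - A M` annihilates `A` and `M` commutes with `A`, then `A + α J` is invertible. -/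
theorem isUnit_add_smul_of_mul_eq_zero (hAM : Commute A M) (hM : A * M = 1 - J)
    (hAJ : A * J = 0) {α : K} (hα : α ≠ 0) : IsUnit (A + α • J) := by
  have hJ : J = 1 - A * M := by rw [hM, sub_sub_cancel]
  have hJM : J * M = M * J := by
    rw [hJ, sub_mul, mul_sub, one_mul, mul_one, ← mul_assoc, ← hAM.eq]
  have hJA : J * A = 0 := by
    rw [← hAJ, hJ, sub_mul, mul_sub, one_mul, mul_one, mul_assoc, hAM.eq]
  have hJJ : J * J = J := by
    nth_rw 2 [hJ]
    rw [mul_sub, mul_one, ← mul_assoc, hJA, zero_mul, sub_zero]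
  -- The inverse is assembled blockwise: `M` inverts `A` on the range of `1 - J`, and `α⁻¹` inverts
  -- `α` on the range of `J`.
  refine IsUnit.of_mul_eq_one (M * (1 - J) + α⁻¹ • J) ?_
  have h1 : A * (M * (1 - J)) = 1 - J := by
    rw [← mul_assoc, hM, mul_sub, mul_one, sub_mul, hJJ, one_mul, sub_self, sub_zero]
  have h2 : J * (M * (1 - J)) = 0 := by
    rw [← mul_assoc, hJM, mul_assoc, mul_sub, mul_one, hJJ, sub_self, mul_zero]
  rw [add_mul, mul_add, mul_add, h1, mul_smul_comm, hAJ, smul_mul_assoc, h2, smul_mul_assoc,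
    mul_smul_comm, hJJ, smul_smul, mul_inv_cancel₀ hα]
  simp

theorem roots_charpoly_add_smul [IsAlgClosed K] [CharZero K] [DecidableEq K]
    (hAM : Commute A M) (hM : A * M = 1 - J) (hAJ : A * J = 0) {d : ℕ} (htr : J.trace = d)
    (α : K) :
    (A + α • J).charpoly.roots =
      A.charpoly.roots.filter (fun μ => μ ≠ 0) + Multiset.replicate d α := by
  have hJ : J = 1 - A * M := by rw [hM, sub_sub_cancel]
  have hJA : J * A = 0 := by
    rw [← hAJ, hJ, sub_mul, mul_sub, one_mul, mul_one, mul_assoc, hAM.eq]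
  have hJJ : J * J = J := by
    nth_rw 2 [hJ]
    rw [mul_sub, mul_one, ← mul_assoc, hJA, zero_mul, sub_zero]
  have hroots : ∀ {α : K}, α ≠ 0 →
      A.charpoly.roots + (Multiset.replicate (Fintype.card V - d) 0 + Multiset.replicate d α) =
      Multiset.replicate (Fintype.card V) 0 + (A + α • J).charpoly.roots := by
    intro α hα
    rw [← (roots_charpoly_smul_of_isIdempotentElem hJJ htr hα).1, ← roots_mul
      (mul_ne_zero (charpoly_monic _).ne_zero (charpoly_monic _).ne_zero),
      ← Multiset.nsmul_singleton, ← roots_X_pow, ← roots_mul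
      (mul_ne_zero (pow_ne_zero _ X_ne_zero) (charpoly_monic _).ne_zero)]
    congr 1
    have hA' : A.map C * J.map C = (0 : Matrix V V K[X]) := by
      rw [← Matrix.map_mul, hAJ, Matrix.map_zero _ C_0]
    have hα' : (α • J).map C = (C α : K[X]) • J.map C := by
      ext1 i j
      simp
    have h : A.charmatrix * (α • J).charmatrix =
        (X : K[X]) • (A + α • J).charmatrix := by
      simp only [charmatrix, scalar_apply, ← smul_one_eq_diagonal, RingHom.mapMatrix_apply,
        Matrix.map_add _ (fun a b => C_add (a := a) (b := b)), hα', sub_mul, mul_sub,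
        smul_mul_assoc, mul_smul_comm, one_mul, mul_one, hA', sub_zero, smul_add,
        smul_sub, smul_smul]
      module
    have h2 := congrArg det h
    rwa [det_mul, det_smul] at h2
  -- Take `α = 1`: since `A + J` is invertible, comparing multiplicities of 0 leaves `count + (n -
  -- d) = n`.
  have h0 : A.charpoly.roots.count 0 = d := by
    have h := congrArg (Multiset.count 0) (hroots (one_ne_zero (α := K)))
    have hle := (roots_charpoly_smul_of_isIdempotentElem hJJ htr (one_ne_zero (α := K))).2
    have hu : (A + (1 : K) • J).charpoly.roots.count 0 = 0 := by
      rw [Multiset.count_eq_zero]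
      intro hr
      have h1 := isRoot_of_mem_roots hr
      rw [IsRoot, eval_charpoly, map_zero, zero_sub, det_neg] at h1
      have h2 := (isUnit_iff_isUnit_det _).1
        (isUnit_add_smul_of_mul_eq_zero hAM hM hAJ (one_ne_zero (α := K)))
      exact h2.ne_zero (by simpa using h1)
    simp only [Multiset.count_add, hu, Multiset.count_replicate, if_true,
      if_neg (one_ne_zero (α := K))] at h
    omega
  have hfilter : A.charpoly.roots =
      A.charpoly.roots.filter (fun μ => μ ≠ 0) + Multiset.replicate d 0 := by
    rw [← h0, ← Multiset.filter_eq', add_comm]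
    exact (Multiset.filter_add_not _ _).symm
  by_cases hα : α = 0
  · rw [hα, zero_smul, add_zero]
    exact hfilter
  · have h := hroots hα
    have hle := (roots_charpoly_smul_of_isIdempotentElem hJJ htr hα).2
    rw [hfilter] at h
    have h3 : Multiset.replicate (Fintype.card V) (0 : K) =
        Multiset.replicate d 0 + Multiset.replicate (Fintype.card V - d) 0 := by
      rw [← Multiset.replicate_add]
      congr 1
      omega
    rw [h3] at h
    refine add_left_cancel (a := Multiset.replicate d (0 : K) +
      Multiset.replicate (Fintype.card V - d) 0) ?_
    rw [← h]
    abel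

end Matrix

end SpectralProjection

/-! ### Maximum in-forests give the projection -/

namespace WeightedDigraph

open Finset

variable {V : Type*} [Fintype V] [DecidableEq V] (Γ : WeightedDigraph V)

theorem exists_numTrees_eq_inForestDim : ∃ F ∈ Γ.inForests, numTrees F = Γ.inForestDim := by
  -- The arcless forest makes the set nonempty, so the infimum is attained and is not the default
  -- value 0.
  refine Nat.sInf_mem (s := {t | ∃ F ∈ Γ.inForests, numTrees F = t}) ⟨_, ∅, ?_, rfl⟩
  rw [mem_inForests]
  refine ⟨empty_subset _, fun u v v' h => ?_, fun i => ⟨i, .refl, fun v => ?_⟩⟩ <;> simp_all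

theorem inForestDim_le_card : Γ.inForestDim ≤ Fintype.card V := by
  obtain ⟨F, hF, h⟩ := Γ.exists_numTrees_eq_inForestDim
  have := ((Γ.mem_inForests).1 hF).2.numTrees_add_card
  omega

theorem inForestsWith_eq_empty {k : ℕ} (hk : Fintype.card V - Γ.inForestDim < k) :
    Γ.inForestsWith k = ∅ := by
  rw [eq_empty_iff_forall_notMem]
  intro F hF
  rw [mem_inForestsWith] at hF
  have h1 := hF.1.2.numTrees_add_card
  have h2 : Γ.inForestDim ≤ numTrees F :=
    Nat.sInf_le ⟨F, (Γ.mem_inForests).2 hF.1, rfl⟩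
  omega

theorem sigma_card_sub_inForestDim_pos : 0 < Γ.sigma (Fintype.card V - Γ.inForestDim) := by
  obtain ⟨F, hF, h⟩ := Γ.exists_numTrees_eq_inForestDim
  have h1 := ((Γ.mem_inForests).1 hF).2.numTrees_add_card
  refine sum_pos (fun F hF => prod_pos fun e he => ?_) ⟨F, ?_⟩
  · have h2 := ((Γ.mem_inForestsWith).1 hF).1.1 he
    rw [arcs, mem_filter] at h2
    exact (Γ.weight_nonneg _ _).lt_of_ne' h2.2
  · rw [mem_inForestsWith]
    exact ⟨(Γ.mem_inForests).1 hF, by omega⟩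

theorem laplacian_mul_forestMatrix_card_sub_inForestDim :
    Γ.laplacian * Γ.forestMatrix (Fintype.card V - Γ.inForestDim) = 0 := by
  have h := Γ.forestMatrix_succ_and_zero.1 (Fintype.card V - Γ.inForestDim)
  have h0 := Γ.inForestsWith_eq_empty (Nat.lt_succ_self _)
  have h1 : Γ.forestMatrix (Fintype.card V - Γ.inForestDim + 1) = 0 := by
    ext i j
    rw [forestMatrix, Matrix.of_apply, inForestsFromTo, h0, filter_empty, sum_empty]
    rfl
  rwa [h1, sigma, h0, sum_empty, zero_smul, zero_add] at h

theorem commute_laplacian_forestMatrix (k : ℕ) :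
    Commute Γ.laplacian (Γ.forestMatrix k) := by
  induction k with
  | zero =>
    rw [Γ.forestMatrix_succ_and_zero.2]
    exact (Commute.one_right _).smul_right _
  | succ k ih =>
    rw [eq_sub_of_add_eq (Γ.forestMatrix_succ_and_zero.1 k)]
    exact ((Commute.one_right _).smul_right _).sub_right ((Commute.refl _).mul_right ih)

theorem exists_laplacian_mul_eq_one_sub :
    ∃ M, Commute Γ.laplacian M ∧ Γ.laplacian * M = 1 - Γ.maxForestMatrix := by
  have hσ := Γ.sigma_card_sub_inForestDim_pos.ne'
  rw [maxForestMatrix, normalizedForestMatrix]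
  generalize Fintype.card V - Γ.inForestDim = K at hσ
  cases K with
  | zero =>
    -- When `n = d` there is no preceding forest matrix; here `J = 1`, so `M = 0` serves.
    refine ⟨0, Commute.zero_right _, ?_⟩
    rw [Γ.forestMatrix_succ_and_zero.2, smul_smul, inv_mul_cancel₀ hσ, one_smul, sub_self,
      mul_zero]
  | succ k =>
    refine ⟨(Γ.sigma (k + 1))⁻¹ • Γ.forestMatrix k,
      (Γ.commute_laplacian_forestMatrix k).smul_right _, ?_⟩
    rw [mul_smul_comm, eq_sub_of_add_eq' (Γ.forestMatrix_succ_and_zero.1 k), smul_sub, smul_smul,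
      inv_mul_cancel₀ hσ, one_smul]

/-- A maximum forest adds its weight to the diagonal once for each of its `d` roots, so the
unnormalized trace is `d` times the total weight. -/
theorem trace_maxForestMatrix : Γ.maxForestMatrix.trace = Γ.inForestDim := by
  classical
  have hσ := Γ.sigma_card_sub_inForestDim_pos.ne'
  have hd := Γ.inForestDim_le_card
  rw [maxForestMatrix, normalizedForestMatrix, Matrix.trace_smul, smul_eq_mul,
    inv_mul_eq_iff_eq_mul₀ hσ, Matrix.trace]
  simp only [Matrix.diag_apply, forestMatrix_apply, sigma_eq]
  rw [sum_comm, sum_mul]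
  refine sum_congr rfl fun F hF => ?_
  have hF := (mem_filter.1 hF).2
  have h1 := hF.numTrees_add_card
  split_ifs with h
  · have h2 : ∀ x, (RootOf F x x ∧ F.card = Fintype.card V - Γ.inForestDim) ↔
        IsTerminal F x := fun x => ⟨fun h => h.1.2, fun h' => ⟨⟨.refl, h'⟩, h⟩⟩
    simp only [h2]
    rw [← sum_filter, sum_const, nsmul_eq_mul, mul_comm]
    have h3 : numTrees F = Γ.inForestDim := by omega
    rw [← h3, hF.numTrees_eq]
  · simp [h]

end WeightedDigraph

/-- The multiset of eigenvalues of a complex matrix, with algebraic multiplicities, is the multiset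
of roots of its characteristic polynomial. -/
theorem proposition10 {V : Type*} [Fintype V] [DecidableEq V] (Γ : WeightedDigraph V) :
    (∀ α : ℂ,
      (Γ.laplacianC + α • Γ.maxForestMatrixC).charpoly.roots =
          Γ.laplacianC.charpoly.roots.filter (fun μ => μ ≠ 0) +
            Multiset.replicate Γ.inForestDim α ∧
        ((α = 0 ∨ α ∉ Γ.laplacianC.charpoly.roots) →
          (Γ.laplacianC + α • Γ.maxForestMatrixC).charpoly.rootMultiplicity α =
            Γ.inForestDim)) ∧
    (∀ α : ℂ, α ≠ 0 → IsUnit (Γ.laplacianC + α • Γ.maxForestMatrixC)) := by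
  obtain ⟨M, hcomm, hM⟩ := Γ.exists_laplacian_mul_eq_one_sub
  -- The real matrix relations pass to `ℂ` along a ring homomorphism; the root count needs an
  -- algebraically closed field.
  let φ : Matrix V V ℝ →+* Matrix V V ℂ := Complex.ofRealHom.mapMatrix
  have hcommC : Commute Γ.laplacianC (φ M) := hcomm.map φ
  have hMC : Γ.laplacianC * φ M = 1 - Γ.maxForestMatrixC := by
    have := congrArg φ hM
    rwa [map_mul, map_sub, map_one] at this
  have hLJ : Γ.laplacian * Γ.maxForestMatrix = 0 := by
    rw [WeightedDigraph.maxForestMatrix, WeightedDigraph.normalizedForestMatrix, mul_smul_comm,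
      Γ.laplacian_mul_forestMatrix_card_sub_inForestDim, smul_zero]
  have hLJC : Γ.laplacianC * Γ.maxForestMatrixC = 0 := by
    have := congrArg φ hLJ
    rwa [map_mul, map_zero] at this
  have htr : Γ.maxForestMatrixC.trace = Γ.inForestDim := by
    have := (AddMonoidHom.map_trace Complex.ofRealHom Γ.maxForestMatrix).symm
    rw [Γ.trace_maxForestMatrix, map_natCast] at this
    exact this
  refine ⟨fun α => ?_, fun α hα => Matrix.isUnit_add_smul_of_mul_eq_zero hcommC hMC hLJC hα⟩
  have hroots := Matrix.roots_charpoly_add_smul hcommC hMC hLJC htr α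
  have hroots' : (Γ.laplacianC + α • Γ.maxForestMatrixC).charpoly.roots =
      Γ.laplacianC.charpoly.roots.filter (fun μ => μ ≠ 0) +
        Multiset.replicate Γ.inForestDim α := by
    convert hroots
  refine ⟨hroots', fun h => ?_⟩
  rw [← Polynomial.count_roots, hroots', Multiset.count_add, Multiset.count_replicate_self,
    Nat.add_eq_right, Multiset.count_eq_zero, Multiset.mem_filter]
  rintro ⟨h1, h2⟩
  exact h.elim h2 fun h => h h1
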